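/- Let $k$ be an algebraically closed field of characteristic zero and let $X$ be an algebraic variety over $k$ (reduced, separated and of finite type over $k$, not necessarily irreducible). Call two (closed) points $x, y$ of $X$ equivalent, $x\sim y$, if the local rings $\mathcal O_{X,x}$ and $\mathcal O_{X,y}$ are isomorphic as $k$-algebras. Suppose that $\sim$ has a finite equivalence class $C$ that meets every irreducible component of $X$ (for irreducible $X$ this is automatic, so that any finite equivalence class will do). Then the group $\mathrm{Aut}(X)$ of automorphisms of $X$ over $k$ is Jordan: there is a positive integer $J$ such that every finite subgroup $K$ of $\mathrm{Aut}(X)$ contains a normal abelian subgroup whose index in $K$ is at most $J$. -/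

import Mathlib

open CategoryTheory AlgebraicGeometry

universe u

/-- A group `G` is Jordan if there is a positive integer `J` such that every finite subgroup `K`
of `G` contains a normal abelian subgroup whose index in `K` is at most `J`. -/
def IsJordanGroup (G : Type*) [Group G] : Prop :=
  ∃ J : ℕ, 0 < J ∧ ∀ K : Subgroup G, Finite K →
    ∃ A : Subgroup K, A.Normal ∧ IsMulCommutative A ∧ A.index ≤ J

/-- A `k`-scheme is an algebraic variety (not necessarily irreducible) if it is reduced, separated
and of finite type over `k`. It is used here over an algebraically closed field `k` only. -/
class IsAlgebraicVariety {k : Type u} [Field k] (X : Over (Spec (CommRingCat.of k))) : Prop where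
  isReduced : IsReduced X.left
  isSeparated : IsSeparated X.hom
  locallyOfFiniteType : LocallyOfFiniteType X.hom
  quasiCompact : QuasiCompact X.hom

/-- The points of a variety in the classical sense: the closed points of the scheme. -/
abbrev VarietyPoint {k : Type u} [Field k] (X : Over (Spec (CommRingCat.of k))) : Type u :=
  {x : X.left // IsClosed ({x} : Set X.left)}

/-- The structure map `k → 𝒪_{X,x}` of the local ring of `X` at `x` as a `k`-algebra. -/
noncomputable def scalarToLocalRing {k : Type u} [Field k] (X : Over (Spec (CommRingCat.of k)))
    (x : X.left) : k →+* X.left.presheaf.stalk x :=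
  ((Scheme.ΓSpecIso (CommRingCat.of k)).inv ≫ X.hom.appTop ≫
    X.left.presheaf.germ ⊤ x trivial).hom

/-- The equivalence relation on the points of `X`: `x ∼ y` if and only if the local rings of `X`
at `x` and at `y` are isomorphic as `k`-algebras. -/
def localRingSetoid {k : Type u} [Field k] (X : Over (Spec (CommRingCat.of k))) :
    Setoid (VarietyPoint X) where
  r x y := ∃ e : X.left.presheaf.stalk x.1 ≃+* X.left.presheaf.stalk y.1,
    ∀ a : k, e (scalarToLocalRing X x.1 a) = scalarToLocalRing X y.1 a
  iseqv :=
    { refl := fun x => ⟨RingEquiv.refl _, fun _ => rfl⟩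
      symm := fun {x y} ⟨e, he⟩ => ⟨e.symm, fun a => by rw [← he a, RingEquiv.symm_apply_apply]⟩
      trans := fun {x y z} ⟨e, he⟩ ⟨f, hf⟩ =>
        ⟨e.trans f, fun a => by rw [RingEquiv.trans_apply, he a, hf a]⟩ }

/-!
An automorphism of `X` carries a point to an equivalent one, so `Aut X` acts on the finite set `C`,
and the stabilizer of a point `x ∈ C` has index at most `|C|` in any group of automorphisms. A
finite group fixing `x` acts on the local ring at `x`, which is a Noetherian local `k`-algebra with
residue field `k`, hence on the finite-dimensional space `𝒪 / 𝔪 ^ 2`. In characteristic zero an automorphism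
of finite order that is trivial on `𝒪 / 𝔪 ^ 2` is trivial on `𝒪` (`eq_id_of_map_sub_mem_sq`, which
rests on Krull's intersection theorem). Jordan's theorem for this representation therefore yields
a subgroup of bounded index whose commutators act trivially on `𝒪`
(`exists_index_bound_of_localRing`).

Intersecting these subgroups over `x ∈ C` gives a subgroup of bounded index whose commutators act
trivially on the local rings at all points of `C`. Every generic point of `X` specializes to a point
of `C`, and `X` is reduced and separated, so these commutators are trivial
(`eq_of_fromSpecStalk_comp_eq`). The normal core of an abelian subgroup of bounded index is normal,
abelian and of bounded index.

Jordan's theorem for matrices over `ℂ` comes from the unitary trick and Frobenius's argument: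
unitary matrices of a finite group that are close to `1` commute
(`commute_map_of_norm_sub_one_lt`), and the index of the subgroup they generate is bounded by the
number of separated points in a ball (`exists_subgroup_commute_of_norm_le_one`). It passes to any
field of characteristic zero because the entries of finitely many matrices lie in a countable
subfield, which embeds into `ℂ`.
-/

/-! ### Finite groups in the unit ball of a normed ring -/

open scoped commutatorElement

section NormedRing

variable {R G : Type*} [NormedRing R] [Group G]

/-- An element of finite order all of whose powers stay at distance at most `c < 1` from `1` is
trivial: the average `P` of its powers satisfies `D * P = P` and `‖1 - P‖ ≤ c`. -/
lemma eq_one_of_norm_pow_sub_one_le [NormedAlgebra ℝ R] {D : R} {m : ℕ} (hm : m ≠ 0)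
    (hD : D ^ m = 1) {c : ℝ} (hc : c < 1) (h : ∀ j, ‖D ^ j - 1‖ ≤ c) : D = 1 := by
  have hm' : (0 : ℝ) < m := by positivity
  set T : R := ∑ j ∈ Finset.range m, D ^ j with hT
  have hDT : (D - 1) * T = 0 := by rw [hT, mul_geom_sum, hD, sub_self]
  set P : R := (m : ℝ)⁻¹ • T with hP
  have hDP : (D - 1) * P = 0 := by rw [hP, mul_smul_comm, hDT, smul_zero]
  have h1 : P - 1 = (m : ℝ)⁻¹ • ∑ j ∈ Finset.range m, (D ^ j - 1) := by
    rw [Finset.sum_sub_distrib, Finset.sum_const, Finset.card_range, smul_sub, ← hT, ← hP,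
      ← Nat.cast_smul_eq_nsmul ℝ, inv_smul_smul₀ hm'.ne']
  have h2 : ‖P - 1‖ ≤ c := by
    rw [h1, norm_smul, norm_inv, Real.norm_natCast, inv_mul_le_iff₀ hm']
    calc _ ≤ ∑ j ∈ Finset.range m, ‖D ^ j - 1‖ := norm_sum_le _ _
      _ ≤ ∑ j ∈ Finset.range m, c := Finset.sum_le_sum fun j _ => h j
      _ = _ := by simp
  have h3 : D - 1 = -((D - 1) * (P - 1)) := by rw [mul_sub, hDP]; simp
  have h4 : ‖D - 1‖ ≤ ‖D - 1‖ * c := by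
    calc ‖D - 1‖ = ‖(D - 1) * (P - 1)‖ := by conv_lhs => rw [h3, norm_neg]
      _ ≤ ‖D - 1‖ * ‖P - 1‖ := norm_mul_le _ _
      _ ≤ _ := by gcongr
  have h5 : ‖D - 1‖ = 0 := by nlinarith [norm_nonneg (D - 1)]
  exact sub_eq_zero.mp (norm_eq_zero.mp h5)

variable {ρ : G →* R}

lemma norm_map_commutator_sub_one_le (hρ : ∀ g, ‖ρ g‖ ≤ 1) (a b : G) :
    ‖ρ ⁅a, b⁆ - 1‖ ≤ ‖(ρ a - 1) * (ρ b - 1) - (ρ b - 1) * (ρ a - 1)‖ := by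
  have h : ρ ⁅a, b⁆ - 1 =
      ((ρ a - 1) * (ρ b - 1) - (ρ b - 1) * (ρ a - 1)) * ρ (a⁻¹ * b⁻¹) := by
    have h1 : ρ ⁅a, b⁆ = ρ a * ρ b * ρ (a⁻¹ * b⁻¹) := by
      rw [← map_mul, ← map_mul, commutatorElement_def, mul_assoc (a * b)]
    have h2 : ρ b * ρ a * ρ (a⁻¹ * b⁻¹) = 1 := by
      rw [← map_mul, ← map_mul]; simp [mul_assoc]
    have h3 : (ρ a - 1) * (ρ b - 1) - (ρ b - 1) * (ρ a - 1) = ρ a * ρ b - ρ b * ρ a := by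
      noncomm_ring
    rw [h3, sub_mul, h2, h1]
  rw [h]
  calc _ ≤ _ * ‖ρ (a⁻¹ * b⁻¹)‖ := norm_mul_le _ _
    _ ≤ _ * 1 := by gcongr; exact hρ _
    _ = _ := mul_one _

lemma norm_map_commutator_sub_one_le_two_mul (hρ : ∀ g, ‖ρ g‖ ≤ 1) (a b : G) :
    ‖ρ ⁅a, b⁆ - 1‖ ≤ 2 * ‖ρ a - 1‖ * ‖ρ b - 1‖ := by
  refine (norm_map_commutator_sub_one_le hρ a b).trans ((norm_sub_le _ _).trans ?_)
  linarith [norm_mul_le (ρ a - 1) (ρ b - 1), norm_mul_le (ρ b - 1) (ρ a - 1)]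

lemma norm_map_commutator_sub_one_le_two_mul_right (hρ : ∀ g, ‖ρ g‖ ≤ 1) (a b : G) :
    ‖ρ ⁅a, b⁆ - 1‖ ≤ 2 * ‖ρ b - 1‖ := by
  refine (norm_map_commutator_sub_one_le hρ a b).trans ?_
  have : (ρ a - 1) * (ρ b - 1) - (ρ b - 1) * (ρ a - 1) =
    ρ a * (ρ b - 1) - (ρ b - 1) * ρ a := by noncomm_ring
  rw [this]
  refine (norm_sub_le _ _).trans ?_
  have h1 : ‖ρ a * (ρ b - 1)‖ ≤ 1 * ‖ρ b - 1‖ :=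
    (norm_mul_le _ _).trans (by gcongr; exact hρ a)
  have h2 : ‖(ρ b - 1) * ρ a‖ ≤ ‖ρ b - 1‖ * 1 :=
    (norm_mul_le _ _).trans (by gcongr; exact hρ a)
  linarith

lemma commute_map_iff_map_commutator_eq_one (ρ : G →* R) (a b : G) :
    Commute (ρ a) (ρ b) ↔ ρ ⁅a, b⁆ = 1 := by
  have h : ρ a * ρ b = ρ ⁅a, b⁆ * (ρ (b * a)) := by
    rw [← map_mul, ← map_mul, commutatorElement_def]; congr 1; group
  constructor
  · intro hc
    have h2 := hc.eq
    rw [h, ← map_mul] at h2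
    calc ρ ⁅a, b⁆ = ρ (⁅a, b⁆ * (b * a)) * ρ (b * a)⁻¹ := by rw [← map_mul]; congr 1; group
      _ = ρ (b * a) * ρ (b * a)⁻¹ := by rw [h2, map_mul]
      _ = 1 := by rw [← map_mul, mul_inv_cancel, map_one]
  · intro h1
    rw [commute_iff_eq, h, h1, one_mul, map_mul]

variable [NormedAlgebra ℝ R]

/-- Suppose that, in `R`, `a` commutes with its commutator with `b`, and `b` is close to `1`. Then
`⁅a, b⁆ ^ j = ⁅a ^ j, b⁆` is close to `1` for all `j`, and so `⁅a, b⁆` is trivial. -/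
lemma map_commutator_eq_one_of_commute [Finite G] (hρ : ∀ g, ‖ρ g‖ ≤ 1) {a b : G}
    (hb : ‖ρ b - 1‖ < 1 / 2) (hab : Commute (ρ a) (ρ ⁅a, b⁆)) : ρ ⁅a, b⁆ = 1 := by
  have key : ∀ j : ℕ, ρ ⁅a, b⁆ ^ j = ρ ⁅a ^ j, b⁆ := by
    intro j
    induction j with
    | zero => simp
    | succ j ih =>
      have : ⁅a ^ (j + 1), b⁆ = a ^ j * ⁅a, b⁆ * (a ^ j)⁻¹ * ⁅a ^ j, b⁆ := by
        simp only [commutatorElement_def, pow_succ]; group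
      rw [this, map_mul, ← ih, map_mul, map_mul, map_pow, (hab.pow_left j).eq, mul_assoc (ρ ⁅a, b⁆),
        ← map_pow ρ a j, ← map_mul, mul_inv_cancel, map_one, mul_one, pow_succ']
  refine eq_one_of_norm_pow_sub_one_le (m := orderOf ⁅a, b⁆) (orderOf_pos _).ne' ?_
    (c := 2 * ‖ρ b - 1‖) (by linarith) fun j => ?_
  · rw [← map_pow, pow_orderOf_eq_one, map_one]
  · rw [key]
    exact norm_map_commutator_sub_one_le_two_mul_right hρ _ _

/-- Two elements whose images lie within `1 / 2` of `1` have commuting images: a counterexample `b`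
for `a` with `ρ b` closest to `1` is impossible, since `⁅a, b⁆` is closer. -/
lemma commute_map_of_norm_sub_one_lt [Finite G] (hρ : ∀ g, ‖ρ g‖ ≤ 1) {a b : G}
    (ha : ‖ρ a - 1‖ < 1 / 2) (hb : ‖ρ b - 1‖ < 1 / 2) : Commute (ρ a) (ρ b) := by
  by_contra hab
  obtain ⟨c, ⟨hc, hac⟩, hmin⟩ := Set.exists_min_image
    {c : G | ‖ρ c - 1‖ < 1 / 2 ∧ ¬ Commute (ρ a) (ρ c)} (fun c => ‖ρ c - 1‖)
    (Set.toFinite _) ⟨b, hb, hab⟩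
  have hpos : 0 < ‖ρ c - 1‖ := by
    rw [norm_pos_iff, sub_ne_zero]
    intro h
    exact hac (h ▸ Commute.one_right _)
  have hlt : ‖ρ ⁅a, c⁆ - 1‖ < ‖ρ c - 1‖ :=
    (norm_map_commutator_sub_one_le_two_mul hρ a c).trans_lt (by nlinarith)
  have hcomm : Commute (ρ a) (ρ ⁅a, c⁆) := by
    by_contra hcon
    exact (hmin _ ⟨hlt.trans hc, hcon⟩).not_gt hlt
  exact hac ((commute_map_iff_map_commutator_eq_one ρ a c).2
    (map_commutator_eq_one_of_commute hρ hc hcomm))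

/-- Jordan's theorem for a representation by elements of norm at most `1`. The subgroup is generated
by the elements close to `1`; its index is bounded by a packing argument in the ball of radius `2`
of `R`. -/
theorem exists_subgroup_commute_of_norm_le_one [FiniteDimensional ℝ R] [Finite G]
    (hρ : ∀ g, ‖ρ g‖ ≤ 1) :
    ∃ A : Subgroup G, A.index ≤ 5 ^ Module.finrank ℝ R ∧
      ∀ a ∈ A, ∀ b ∈ A, Commute (ρ a) (ρ b) := by
  classical
  set A : Subgroup G := Subgroup.closure {g | ‖ρ g - 1‖ < 1 / 2} with hA
  refine ⟨A, ?_, fun a ha b hb => ?_⟩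
  · have := Fintype.ofFinite (G ⧸ A)
    -- Representatives of distinct cosets are at distance at least `1 / 2`, hence the factor `2`.
    let f : G ⧸ A → R := fun q => (2 : ℝ) • ρ q.out
    have hsep : ∀ p q : G ⧸ A, p ≠ q → 1 ≤ ‖f p - f q‖ := by
      intro p q hpq
      by_contra! hlt
      refine hpq ?_
      rw [← p.out_eq, ← q.out_eq]
      refine QuotientGroup.eq.2 (Subgroup.subset_closure ?_)
      have h1 : ρ (p.out⁻¹ * q.out) - 1 = - (ρ p.out⁻¹ * (ρ p.out - ρ q.out)) := by
        rw [mul_sub, ← map_mul, ← map_mul, inv_mul_cancel, map_one]; abel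
      have h2 : ‖f p - f q‖ = 2 * ‖ρ p.out - ρ q.out‖ := by
        simp only [f]
        rw [← smul_sub, norm_smul]; simp
      have h3 : ‖ρ (p.out⁻¹ * q.out) - 1‖ ≤ 1 * ‖ρ p.out - ρ q.out‖ := by
        rw [h1, norm_neg]
        exact (norm_mul_le _ _).trans (by gcongr; exact hρ _)
      change ‖ρ (p.out⁻¹ * q.out) - 1‖ < 1 / 2
      linarith
    have hinj : Function.Injective f := by
      intro p q hpq
      by_contra hne
      have := hsep p q hne
      simp [hpq] at this
      norm_num at this
    have hcard := Besicovitch.card_le_of_separated (Finset.univ.image f)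
      (by
        simp only [Finset.mem_image, Finset.mem_univ, true_and, forall_exists_index,
          forall_apply_eq_imp_iff]
        intro q
        simp only [f]
        rw [norm_smul, Real.norm_two]
        linarith [hρ q.out])
      (by
        simp only [Finset.mem_image, Finset.mem_univ, true_and, forall_exists_index,
          forall_apply_eq_imp_iff]
        intro p q hne
        exact hsep p q fun h => hne (h ▸ rfl))
    rwa [Finset.card_image_of_injective _ hinj, Finset.card_univ,
      ← Nat.card_eq_fintype_card] at hcard
  · have hinv : ∀ (x : G) (y : R), Commute (ρ x) y → Commute (ρ x⁻¹) y := fun x y h => by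
      have h1 : Commute (ρ.toHomUnits x : R) y := h
      simpa [← map_inv] using h1.units_inv_left
    refine Subgroup.closure_induction₂ (p := fun x y _ _ => Commute (ρ x) (ρ y))
      (fun x y hx hy => commute_map_of_norm_sub_one_lt hρ hx hy) (by simp) (by simp)
      (fun x y z _ _ _ h₁ h₂ => by rw [map_mul]; exact h₁.mul_left h₂)
      (fun x y z _ _ _ h₁ h₂ => by rw [map_mul]; exact h₁.mul_right h₂)
      (fun x y _ _ h => hinv x _ h) (fun x y _ _ h => (hinv y _ h.symm).symm) ha hb

end NormedRing

/-! ### Jordan's theorem for linear groups -/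

section Complex

open Matrix
open scoped Matrix.Norms.L2Operator MatrixOrder ComplexOrder

/-- Weyl's unitary trick: averaging the standard Hermitian form over the group makes a finite linear
group unitary after a change of basis. -/
lemma exists_units_conj_mem_unitary {G : Type*} [Group G] [Finite G] {n : ℕ}
    (ρ : G →* Matrix (Fin n) (Fin n) ℂ) :
    ∃ S : (Matrix (Fin n) (Fin n) ℂ)ˣ, ∀ g, (S.val * ρ g * S⁻¹.val) ∈
      unitary (Matrix (Fin n) (Fin n) ℂ) := by
  classical
  have := Fintype.ofFinite G
  set P : Matrix (Fin n) (Fin n) ℂ := ∑ g, star (ρ g) * ρ g with hP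
  have hpos : P.PosDef := by
    rw [hP, ← Finset.add_sum_erase _ _ (Finset.mem_univ (1 : G))]
    refine PosDef.add_posSemidef (by simpa using PosDef.one)
      (posSemidef_sum _ fun g _ => posSemidef_conjTranspose_mul_self _)
  obtain ⟨B, hB⟩ := CStarAlgebra.nonneg_iff_eq_star_mul_self.mp hpos.posSemidef.nonneg
  have hBu : IsUnit B := by
    have h := hpos.isUnit
    rw [hB] at h
    rw [isUnit_iff_isUnit_det] at h ⊢
    rw [det_mul] at h
    exact isUnit_of_mul_isUnit_right h
  obtain ⟨S, rfl⟩ := hBu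
  have hinv : ∀ g, star (ρ g) * P * ρ g = P := by
    intro g
    rw [hP, Finset.mul_sum, Finset.sum_mul]
    refine Fintype.sum_equiv (Equiv.mulRight g) _ _ fun x => ?_
    simp [mul_assoc]
  refine ⟨S, fun g => ?_⟩
  have hl : star (S.val * ρ g * S⁻¹.val) * (S.val * ρ g * S⁻¹.val) = 1 := by
    calc _ = star S⁻¹.val *
          (star (ρ g) * (star S.val * S.val) * ρ g) * S⁻¹.val := by
            simp only [star_mul, mul_assoc]
      _ = star S⁻¹.val * (star S.val * S.val) *
            S⁻¹.val := by rw [← hB, hinv]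
      _ = star (S.val * S⁻¹.val) * (S.val * S⁻¹.val) := by
            simp only [star_mul, mul_assoc]
      _ = 1 := by simp
  exact Unitary.mem_iff.2 ⟨hl, mul_eq_one_comm.1 hl⟩

/-- Jordan's theorem for complex matrices. -/
theorem exists_subgroup_commute_complex {G : Type*} [Group G] [Finite G] {n : ℕ}
    (ρ : G →* Matrix (Fin n) (Fin n) ℂ) :
    ∃ A : Subgroup G, A.index ≤ 5 ^ (2 * n ^ 2) ∧ ∀ a ∈ A, ∀ b ∈ A, Commute (ρ a) (ρ b) := by
  obtain ⟨S, hS⟩ := exists_units_conj_mem_unitary ρ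
  let σ : G →* Matrix (Fin n) (Fin n) ℂ :=
    { toFun := fun g => S.val * ρ g * S⁻¹.val
      map_one' := by simp
      map_mul' := fun a b => by simp [mul_assoc] }
  have hnorm : ∀ g, ‖σ g‖ ≤ 1 := fun g => by
    rcases subsingleton_or_nontrivial (Matrix (Fin n) (Fin n) ℂ) with h | h
    · simp [Subsingleton.elim (σ g) 0]
    · exact (CStarRing.norm_of_mem_unitary (hS g)).le
  obtain ⟨A, hA, hcomm⟩ := exists_subgroup_commute_of_norm_le_one hnorm
  refine ⟨A, hA.trans_eq ?_, fun a ha b hb => ?_⟩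
  · congr 1
    rw [← Module.finrank_mul_finrank ℝ ℂ, Complex.finrank_real_complex, Module.finrank_matrix]
    simp [pow_two]
  · have h := (hcomm a ha b hb).eq
    have e : ∀ g, ρ g = S⁻¹.val * σ g * S.val := fun g => by simp [σ, mul_assoc]
    rw [commute_iff_eq, e, e]
    simp only [mul_assoc, Units.mul_inv_cancel_left]
    rw [← mul_assoc (σ a), h, mul_assoc]

end Complex

section Embedding

open Cardinal

/-- A countable field of characteristic zero embeds into `ℂ`: an algebraic closure of the field of
rational functions in continuum many variables over it is isomorphic to `ℂ`. -/
lemma nonempty_ringHom_complex (F : Type u) [Field F] [CharZero F] [Countable F] :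
    Nonempty (F →+* ℂ) := by
  let P := MvPolynomial ℝ F
  let Q := FractionRing P
  let L := AlgebraicClosure Q
  have hP : #P = 𝔠 := by
    rw [MvPolynomial.cardinalMk_eq_max_lift, Cardinal.mk_real]
    have h : Cardinal.lift.{0} #F ≤ ℵ₀ := by simp
    rw [Cardinal.lift_continuum, max_eq_right (h.trans Cardinal.aleph0_le_continuum),
      max_eq_left Cardinal.aleph0_le_continuum]
  have hQ : #Q = 𝔠 := by rw [Cardinal.mk_fractionRing, hP]
  have hL : #L = 𝔠 := by
    refine le_antisymm ?_ ?_
    · refine (Algebra.IsAlgebraic.cardinalMk_le_max Q L).trans ?_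
      rw [hQ]; simp [Cardinal.aleph0_le_continuum]
    · rw [← hQ]
      exact Cardinal.mk_le_of_injective (algebraMap Q L).injective
  have : CharZero L := charZero_of_injective_algebraMap (R := F) (A := L) (algebraMap F L).injective
  obtain ⟨e⟩ := IsAlgClosed.ringEquiv_of_equiv_of_charZero (K := L) (L := ℂ)
    (by rw [hL]; simp [Cardinal.aleph0_lt_continuum])
    (Cardinal.lift_mk_eq'.1 (by rw [hL]; simp [Cardinal.mk_complex]))
  exact ⟨e.toRingHom.comp (algebraMap F L)⟩

/-- Jordan's theorem for matrices over a field of characteristic zero. The entries generate a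
countable field, which embeds into `ℂ`. -/
theorem exists_subgroup_commute_matrix {k : Type u} [Field k] [CharZero k] {G : Type*} [Group G]
    [Finite G] {n : ℕ} (ρ : G →* Matrix (Fin n) (Fin n) k) :
    ∃ A : Subgroup G, A.index ≤ 5 ^ (2 * n ^ 2) ∧ ∀ a ∈ A, ∀ b ∈ A, Commute (ρ a) (ρ b) := by
  let s : Set k := Set.range fun x : G × Fin n × Fin n => ρ x.1 x.2.1 x.2.2
  let F := IntermediateField.adjoin ℚ s
  have : Countable F := by
    rw [← Cardinal.mk_le_aleph0_iff]
    simpa using IntermediateField.lift_cardinalMk_adjoin_le ℚ s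
  obtain ⟨f⟩ := nonempty_ringHom_complex F
  have hmem : ∀ g i j, ρ g i j ∈ F := fun g i j =>
    IntermediateField.subset_adjoin ℚ s ⟨(g, i, j), rfl⟩
  let ρ' : G → Matrix (Fin n) (Fin n) F := fun g i j => ⟨ρ g i j, hmem g i j⟩
  have hρ' : ∀ g, F.val.mapMatrix (ρ' g) = ρ g := fun g => rfl
  have hinj : Function.Injective (F.val.mapMatrix (m := Fin n)) :=
    Matrix.map_injective F.val.injective
  let σ : G →* Matrix (Fin n) (Fin n) F :=
    { toFun := ρ'
      map_one' := hinj (by rw [hρ', map_one, map_one])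
      map_mul' := fun a b => hinj (by rw [hρ', map_mul, map_mul, hρ', hρ']) }
  obtain ⟨A, hA, hcomm⟩ := exists_subgroup_commute_complex
    ((f.mapMatrix (m := Fin n)).toMonoidHom.comp σ)
  refine ⟨A, hA, fun a ha b hb => ?_⟩
  have hinj' : Function.Injective (f.mapMatrix (m := Fin n)) := Matrix.map_injective f.injective
  have h : Commute (σ a) (σ b) := by
    refine hinj' ?_
    rw [map_mul, map_mul]
    exact (hcomm a ha b hb).eq
  exact h.map F.val.mapMatrix

/-- Jordan's theorem for a linear representation over a field of characteristic zero. -/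
theorem exists_subgroup_commute_end {k : Type u} [Field k] [CharZero k] {V : Type*} [AddCommGroup V]
    [Module k V] [FiniteDimensional k V] {G : Type*} [Group G] [Finite G]
    (ρ : G →* Module.End k V) :
    ∃ A : Subgroup G, A.index ≤ 5 ^ (2 * Module.finrank k V ^ 2) ∧
      ∀ a ∈ A, ∀ b ∈ A, Commute (ρ a) (ρ b) := by
  let e := LinearMap.toMatrixAlgEquiv (Module.finBasis k V)
  obtain ⟨A, hA, hcomm⟩ := exists_subgroup_commute_matrix (e.toMulEquiv.toMonoidHom.comp ρ)
  refine ⟨A, hA, fun a ha b hb => e.injective ?_⟩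
  rw [map_mul, map_mul]
  exact (hcomm a ha b hb).eq

end Embedding

/-! ### Finite groups acting on a local ring -/

section LocalRing

open IsLocalRing

variable {k R : Type*} [Field k] [CommRing R] [IsLocalRing R] [Algebra k R]

/-- If `R` is Noetherian and its residue field is `k`, then `R / 𝔪 ^ 2` is spanned over `k` by `1`
and any generators of `𝔪`. -/
lemma finite_quotient_maximalIdeal_sq [IsNoetherianRing R]
    (hres : Function.Surjective (algebraMap k (ResidueField R))) :
    Module.Finite k (R ⧸ maximalIdeal R ^ 2) := by
  have hdec : ∀ r : R, ∃ c : k, r - algebraMap k R c ∈ maximalIdeal R := fun r => by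
    obtain ⟨c, hc⟩ := hres (residue R r)
    refine ⟨c, ?_⟩
    rw [← residue_eq_zero_iff, map_sub, ← hc, IsScalarTower.algebraMap_apply k R (ResidueField R)]
    exact sub_self _
  obtain ⟨s, hs⟩ := (isNoetherianRing_iff_ideal_fg R).1 ‹_› (maximalIdeal R)
  let q : R →ₐ[k] R ⧸ maximalIdeal R ^ 2 := Ideal.Quotient.mkₐ k _
  classical
  have hm : ∀ r ∈ Ideal.span (s : Set R), q r ∈ Submodule.span k (q '' insert 1 (s : Set R)) := by
    intro r hr
    induction hr using Submodule.span_induction with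
    | mem x hx => exact Submodule.subset_span ⟨x, Or.inr hx, rfl⟩
    | zero => simp
    | add x y _ _ hx hy => rw [map_add]; exact add_mem hx hy
    | smul a x hx' hx =>
      obtain ⟨c, hc⟩ := hdec a
      have hz : q ((a - algebraMap k R c) * x) = 0 := by
        refine Ideal.Quotient.eq_zero_iff_mem.2 ?_
        rw [pow_two]
        exact Ideal.mul_mem_mul hc (hs ▸ hx')
      rw [sub_mul, map_sub, sub_eq_zero, ← Algebra.smul_def, map_smul] at hz
      rw [smul_eq_mul, hz]
      exact Submodule.smul_mem _ _ hx
  refine ⟨⟨(insert 1 s).image q, ?_⟩⟩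
  rw [eq_top_iff]
  rintro x -
  obtain ⟨r, rfl⟩ := Ideal.Quotient.mk_surjective x
  obtain ⟨c, hc⟩ := hdec r
  have h1 : q r = q (r - algebraMap k R c) + c • q 1 := by
    rw [← map_smul, ← map_add, ← Algebra.algebraMap_eq_smul_one, sub_add_cancel]
  change q r ∈ _
  rw [h1, Finset.coe_image, Finset.coe_insert]
  exact add_mem (hm _ (hs ▸ hc))
    (Submodule.smul_mem _ _ (Submodule.subset_span ⟨1, Or.inl rfl, rfl⟩))

/-- An endomorphism that is trivial modulo `𝔪 ^ 2` is trivial on the associated graded ring. -/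
lemma map_sub_mem_pow_succ {φ : R →+* R}
    (h : ∀ a, φ a - a ∈ maximalIdeal R ^ 2) (j : ℕ) {a : R} (ha : a ∈ maximalIdeal R ^ j) :
    φ a - a ∈ maximalIdeal R ^ (j + 1) := by
  induction j generalizing a with
  | zero => exact Ideal.pow_le_pow_right (by norm_num) (h a)
  | succ j ih =>
    rw [pow_succ] at ha
    induction ha using Submodule.mul_induction_on' with
    | mem_mul_mem x hx y hy =>
      have hφy : φ y ∈ maximalIdeal R := by
        have := add_mem (Ideal.pow_le_self two_ne_zero (h y)) hy
        simpa using this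
      have h1 : φ (x * y) - x * y = (φ x - x) * φ y + x * (φ y - y) := by rw [map_mul]; ring
      rw [h1]
      refine add_mem ?_ ?_
      · rw [pow_succ]
        exact Ideal.mul_mem_mul (ih hx) hφy
      · rw [show j + 1 + 1 = j + 2 by ring, pow_add]
        exact Ideal.mul_mem_mul hx (h y)
    | add x _ y _ hx hy =>
      rw [map_add, show φ x + φ y - (x + y) = (φ x - x) + (φ y - y) by ring]
      exact add_mem hx hy

/-- In characteristic zero, an endomorphism of finite order of a Noetherian local ring that is
trivial modulo `𝔪 ^ 2` is the identity: if `φ a - a` lies in `𝔪 ^ j`, then `φ ^ i` moves `a` by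
`i * (φ a - a)` modulo `𝔪 ^ (j + 1)`, so that `φ a - a` lies in `𝔪 ^ (j + 1)`. -/
lemma eq_id_of_map_sub_mem_sq [IsNoetherianRing R] [CharZero k] {φ : R →+* R} {m : ℕ}
    (hm : m ≠ 0) (hφ : φ ^ m = 1) (h : ∀ a, φ a - a ∈ maximalIdeal R ^ 2) : φ = 1 := by
  have key : ∀ j a, φ a - a ∈ maximalIdeal R ^ j := by
    intro j
    induction j with
    | zero => simp
    | succ j ih =>
      intro a
      have hpow : ∀ i : ℕ, (φ ^ i) a - a - i * (φ a - a) ∈ maximalIdeal R ^ (j + 1) := by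
        intro i
        induction i with
        | zero => simp
        | succ i hi =>
          have h1 := map_sub_mem_pow_succ h j (ih a)
          have h2 := map_sub_mem_pow_succ h (j + 1) hi
          have h3 : (φ ^ (i + 1)) a - a - (i + 1 : ℕ) * (φ a - a) =
              (φ ((φ ^ i) a - a - i * (φ a - a)) - ((φ ^ i) a - a - i * (φ a - a))) +
              i * (φ (φ a - a) - (φ a - a)) + ((φ ^ i) a - a - i * (φ a - a)) := by
            rw [pow_succ', RingHom.mul_def, RingHom.comp_apply]
            simp only [map_sub, map_mul, map_natCast]
            push_cast
            ring
          rw [h3]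
          exact add_mem (add_mem (Ideal.pow_le_pow_right (by omega) h2)
            (Ideal.mul_mem_left _ _ h1)) hi
      have hm1 := hpow m
      rw [hφ, RingHom.one_def, RingHom.id_apply, sub_self, zero_sub, neg_mem_iff] at hm1
      have hunit : IsUnit (m : R) := by
        have : IsUnit (algebraMap k R m) := (IsUnit.mk0 (m : k) (by exact_mod_cast hm)).map _
        simpa using this
      exact (Ideal.unit_mul_mem_iff_mem _ hunit).1 hm1
  ext a
  have : φ a - a ∈ (⨅ j, maximalIdeal R ^ j : Ideal R) := by
    simpa [Ideal.mem_iInf] using fun j => key j a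
  rw [Ideal.iInf_pow_eq_bot_of_isLocalRing _ (Ideal.IsPrime.ne_top inferInstance)] at this
  exact sub_eq_zero.1 this

variable (k) in
/-- Jordan's theorem for finite groups acting on a Noetherian local `k`-algebra with residue field
`k`, by way of the representation on `R / 𝔪 ^ 2`. -/
theorem exists_index_bound_of_localRing [CharZero k] [IsNoetherianRing R]
    (hres : Function.Surjective (algebraMap k (ResidueField R))) :
    ∃ J : ℕ, ∀ {G : Type*} [Group G] [Finite G] (ρ : G →* (R →ₐ[k] R)),
      ∃ A : Subgroup G, A.index ≤ J ∧ ∀ a ∈ A, ∀ b ∈ A, ρ a * ρ b = ρ b * ρ a := by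
  have := finite_quotient_maximalIdeal_sq hres
  refine ⟨5 ^ (2 * Module.finrank k (R ⧸ maximalIdeal R ^ 2) ^ 2), fun {G} _ _ ρ => ?_⟩
  -- An endomorphism with an inverse maps non-units to non-units.
  have hle : ∀ g, maximalIdeal R ^ 2 ≤ (maximalIdeal R ^ 2).comap (ρ g) := fun g => by
    have h1 : maximalIdeal R ≤ (maximalIdeal R).comap (ρ g) := fun a ha => by
      by_contra hcon
      have hu : IsUnit (ρ g a) := by simpa using hcon
      refine ha ?_
      have := hu.map (ρ g⁻¹)
      rwa [← AlgHom.mul_apply, ← map_mul, inv_mul_cancel, map_one, AlgHom.one_apply] at this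
    exact (Ideal.pow_right_mono h1 2).trans (Ideal.le_comap_pow _ 2)
  let τ : G →* Module.End k (R ⧸ maximalIdeal R ^ 2) :=
    { toFun := fun g => (Ideal.quotientMapₐ _ (ρ g) (hle g)).toLinearMap
      map_one' := by
        refine LinearMap.ext fun x => ?_
        obtain ⟨x, rfl⟩ := Ideal.Quotient.mk_surjective x
        change Ideal.Quotient.mk _ (ρ 1 x) = Ideal.Quotient.mk _ x
        rw [map_one, AlgHom.one_apply]
      map_mul' := fun a b => by
        refine LinearMap.ext fun x => ?_
        obtain ⟨x, rfl⟩ := Ideal.Quotient.mk_surjective x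
        change Ideal.Quotient.mk _ (ρ (a * b) x) = Ideal.Quotient.mk _ (ρ a (ρ b x))
        rw [map_mul, AlgHom.mul_apply] }
  have hτ : ∀ g r, τ g (Ideal.Quotient.mk _ r) = Ideal.Quotient.mk _ (ρ g r) := fun g r => rfl
  obtain ⟨A, hA, hcomm⟩ := exists_subgroup_commute_end τ
  refine ⟨A, hA, fun a ha b hb => ?_⟩
  have hone : τ (a * b * (b * a)⁻¹) = 1 := by
    rw [map_mul, map_mul, (hcomm a ha b hb).eq, ← map_mul, ← map_mul, mul_inv_cancel, map_one]
  set g := a * b * (b * a)⁻¹ with hg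
  have hid : (ρ g : R →+* R) = 1 := by
    refine eq_id_of_map_sub_mem_sq (k := k) (m := orderOf g) (orderOf_pos g).ne' ?_ fun r => ?_
    · have h1 : ∀ i : ℕ, (ρ g : R →+* R) ^ i = (ρ (g ^ i) : R →+* R) := fun i => by
        induction i with
        | zero => ext; simp
        | succ i ih => rw [pow_succ, ih, pow_succ g, map_mul ρ (g ^ i) g]; rfl
      rw [h1, pow_orderOf_eq_one, map_one]; rfl
    · rw [← Ideal.Quotient.eq_zero_iff_mem, map_sub, sub_eq_zero]
      change Ideal.Quotient.mk _ (ρ g r) = _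
      rw [← hτ, hone]; rfl
  have hid' : ρ g = 1 := by
    ext r
    exact DFunLike.congr_fun hid r
  rw [← map_mul, ← map_mul, show a * b = g * (b * a) by rw [hg, inv_mul_cancel_right], map_mul,
    hid', one_mul]

end LocalRing

/-! ### Automorphisms of a variety and their action on local rings -/

section Variety

variable {k : Type u} [Field k] (X : Over (Spec (CommRingCat.of k)))

lemma specMap_scalarToLocalRing (x : X.left) :
    Spec.map (CommRingCat.ofHom (scalarToLocalRing X x)) = X.left.fromSpecStalk x ≫ X.hom := by
  have h : CommRingCat.ofHom (scalarToLocalRing X x) =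
      (Scheme.ΓSpecIso (CommRingCat.of k)).inv ≫ X.hom.appTop ≫
        X.left.presheaf.germ ⊤ x trivial := rfl
  rw [h, Spec.map_comp, Spec.map_comp, ← Scheme.fromSpecStalk_toSpecΓ, Category.assoc,
    Category.assoc, ← Scheme.toSpecΓ_naturality_assoc]
  rw [← AlgebraicGeometry.SpecMap_ΓSpecIso_hom, ← Spec.map_comp, Iso.inv_hom_id, Spec.map_id]
  simp

variable {X}

/-- A `k`-morphism induces a `k`-algebra homomorphism of local rings. -/
lemma stalkMap_scalarToLocalRing (f : X ⟶ X) (x : X.left) (a : k) :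
    f.left.stalkMap x (scalarToLocalRing X (f.left x) a) = scalarToLocalRing X x a := by
  have h : CommRingCat.ofHom (scalarToLocalRing X (f.left x)) ≫ f.left.stalkMap x =
      CommRingCat.ofHom (scalarToLocalRing X x) := by
    apply Spec.map_injective
    rw [Spec.map_comp, specMap_scalarToLocalRing, specMap_scalarToLocalRing,
      Scheme.SpecMap_stalkMap_fromSpecStalk_assoc, Over.w]
  exact DFunLike.congr_fun (CommRingCat.hom_ext_iff.mp h) a

instance isIso_left_hom (g : Aut X) : IsIso g.hom.left :=
  have : IsIso g.hom := Iso.isIso_hom g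
  inferInstanceAs (IsIso ((Over.forget _).map g.hom))

/-- `Aut X` acts on the points of `X`. -/
noncomputable instance : MulAction (Aut X) (VarietyPoint X) where
  smul g x := ⟨g.hom.left x.1, by
    have h := (Scheme.Hom.homeomorph g.hom.left).isClosedMap _ x.2
    rwa [Set.image_singleton] at h⟩
  one_smul x := Subtype.ext rfl
  mul_smul g h x := Subtype.ext rfl

/-- Automorphisms of `X` preserve the equivalence classes of points. -/
lemma localRingSetoid_smul (g : Aut X) (x : VarietyPoint X) : localRingSetoid X x (g • x) := by
  refine ⟨(asIso (g.hom.left.stalkMap x.1)).symm.commRingCatIsoToRingEquiv, fun a => ?_⟩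
  rw [← RingEquiv.eq_symm_apply]
  exact (stalkMap_scalarToLocalRing g.hom x.1 a).symm

/-- An endomorphism of `X` fixing `x` restricts to the spectrum of the local ring at `x`. -/
lemma exists_specMap_fromSpecStalk {x : X.left} (f : X ⟶ X) (hf : f.left x = x) :
    ∃ φ : X.left.presheaf.stalk x ⟶ X.left.presheaf.stalk x,
      Spec.map φ ≫ X.left.fromSpecStalk x = X.left.fromSpecStalk x ≫ f.left := by
  refine ⟨X.left.presheaf.stalkSpecializes (specializes_of_eq hf) ≫ f.left.stalkMap x, ?_⟩
  rw [Spec.map_comp, Category.assoc, Scheme.SpecMap_stalkSpecializes_fromSpecStalk,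
    Scheme.SpecMap_stalkMap_fromSpecStalk]

/-- By the Nullstellensatz, the residue field of a point of a variety over an algebraically closed
field is `k`. -/
lemma surjective_residue_scalarToLocalRing [IsAlgClosed k] [LocallyOfFiniteType X.hom]
    (x : VarietyPoint X) : Function.Surjective
      ((IsLocalRing.residue (X.left.presheaf.stalk x.1)).comp (scalarToLocalRing X x.1)) := by
  have h : (residueFieldIsoBase (K := k) X.hom x.1 x.2).inv =
      CommRingCat.ofHom (scalarToLocalRing X x.1) ≫ X.left.residue x.1 := by
    apply Spec.map_injective
    rw [SpecMap_residueFieldIsoBase_inv, Spec.map_comp, specMap_scalarToLocalRing]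
    rfl
  have h2 :=
    ((residueFieldIsoBase (K := k) X.hom x.1 x.2).symm.commRingCatIsoToRingEquiv).surjective
  intro y
  obtain ⟨a, ha⟩ := h2 y
  refine ⟨a, ?_⟩
  rw [← ha]
  exact (DFunLike.congr_fun (CommRingCat.hom_ext_iff.mp h) a).symm

/-- Jordan's theorem at a fixed point, with a bound that depends on the point only. The conclusion
says that the inverses of `a * b` and `b * a` act in the same way on the local ring at `x`. -/
lemma exists_index_bound_of_fixed [IsAlgClosed k] [CharZero k] [LocallyOfFiniteType X.hom]
    (x : VarietyPoint X) :
    ∃ J : ℕ, ∀ {G : Type u} [Group G] [Finite G] (σ : G →* Aut X), (∀ g, σ g • x = x) →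
      ∃ A : Subgroup G, A.index ≤ J ∧ ∀ a ∈ A, ∀ b ∈ A,
        X.left.fromSpecStalk x.1 ≫ (σ (a * b)⁻¹).hom.left =
          X.left.fromSpecStalk x.1 ≫ (σ (b * a)⁻¹).hom.left := by
  have : IsLocallyNoetherian X.left := LocallyOfFiniteType.isLocallyNoetherian X.hom
  let R := X.left.presheaf.stalk x.1
  let _ : Algebra k R := (scalarToLocalRing X x.1).toAlgebra
  obtain ⟨J, hJ⟩ := exists_index_bound_of_localRing k (R := R)
    (surjective_residue_scalarToLocalRing x)
  refine ⟨J, fun {G} _ _ σ hσ => ?_⟩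
  have hfix : ∀ g, (σ g).hom.left x.1 = x.1 := fun g => congrArg Subtype.val (hσ g)
  choose φ hφ using fun g => exists_specMap_fromSpecStalk (σ g).hom (hfix g)
  have hφ_one : φ 1 = 𝟙 _ := by
    apply Spec.map_injective
    rw [← cancel_mono (X.left.fromSpecStalk x.1), hφ, map_one]
    simp
    rfl
  have hφ_mul : ∀ a b, φ (a * b) = φ a ≫ φ b := fun a b => by
    apply Spec.map_injective
    rw [← cancel_mono (X.left.fromSpecStalk x.1), hφ, map_mul, Spec.map_comp, Category.assoc, hφ a,
      reassoc_of% (hφ b)]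
    rfl
  have hφ_alg : ∀ g a, φ g (scalarToLocalRing X x.1 a) = scalarToLocalRing X x.1 a := fun g a => by
    have h : CommRingCat.ofHom (scalarToLocalRing X x.1) ≫ φ g =
        CommRingCat.ofHom (scalarToLocalRing X x.1) := by
      apply Spec.map_injective
      rw [Spec.map_comp, specMap_scalarToLocalRing, reassoc_of% (hφ g), Over.w]
    exact DFunLike.congr_fun (CommRingCat.hom_ext_iff.mp h) a
  -- `φ` reverses products of endomorphisms of the local ring, hence the inverse.
  let ρ : G →* (R →ₐ[k] R) :=
    { toFun := fun g => { (φ g⁻¹).hom with commutes' := hφ_alg g⁻¹ }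
      map_one' := by
        ext r
        change φ (1 : G)⁻¹ r = r
        rw [inv_one, hφ_one]; rfl
      map_mul' := fun a b => by
        ext r
        change φ (a * b)⁻¹ r = φ a⁻¹ (φ b⁻¹ r)
        rw [mul_inv_rev, hφ_mul]; rfl }
  obtain ⟨A, hA, hcomm⟩ := hJ ρ
  refine ⟨A, hA, fun a ha b hb => ?_⟩
  have h := hcomm a ha b hb
  rw [← map_mul, ← map_mul] at h
  have h' : φ (a * b)⁻¹ = φ (b * a)⁻¹ := by
    ext r
    exact DFunLike.congr_fun h r
  rw [← hφ, ← hφ, h']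

/-- Two `k`-endomorphisms of a reduced separated `X` that agree on the spectra of the local rings at
a set of points meeting all irreducible components are equal: they agree at
the generic points of the components. -/
lemma eq_of_fromSpecStalk_comp_eq [IsReduced X.left] [IsSeparated X.hom] {C : Set (VarietyPoint X)}
    (hmeet : ∀ Z ∈ irreducibleComponents X.left, ∃ x ∈ C, x.1 ∈ Z) {f g : X ⟶ X}
    (h : ∀ x ∈ C, X.left.fromSpecStalk x.1 ≫ f.left = X.left.fromSpecStalk x.1 ≫ g.left) :
    f = g := by
  ext1
  refine ext_of_fromSpecResidueField_eq f.left g.left X.hom {y | ∃ x ∈ C, y ⤳ x.1} (fun y => ?_) ?_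
    (by rw [Over.w, Over.w])
  · -- Density: the generic point `η` of a component through `y` specializes to `y` and to a point
    -- of `C`.
    obtain ⟨x, hxC, hx⟩ := hmeet _ (irreducibleComponent_mem_irreducibleComponents y)
    have hirr : IsIrreducible (irreducibleComponent y) := isIrreducible_irreducibleComponent
    obtain ⟨η, hη⟩ := QuasiSober.sober hirr isClosed_irreducibleComponent
    refine closure_mono (s := {η}) ?_ (hη.symm ▸ mem_irreducibleComponent)
    rw [Set.singleton_subset_iff]
    exact ⟨x, hxC, hη.specializes hx⟩
  · rintro y ⟨x, hxC, hyx⟩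
    have hy : X.left.fromSpecResidueField y = Spec.map (X.left.residue y) ≫
        Spec.map (X.left.presheaf.stalkSpecializes hyx) ≫ X.left.fromSpecStalk x.1 := by
      rw [Scheme.SpecMap_stalkSpecializes_fromSpecStalk]; rfl
    rw [hy]
    simp only [Category.assoc, h x hxC]

end Variety

/-- The index of the normal core is bounded in terms of the index. -/
lemma index_normalCore_le_factorial {G : Type*} [Group G] (H : Subgroup G) [H.FiniteIndex] :
    H.normalCore.index ≤ H.index.factorial := by
  rw [Subgroup.normalCore_eq_ker, Subgroup.index_ker, Subgroup.index_eq_card, ← Nat.card_perm]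
  exact Subgroup.card_le_card_group _

theorem mainTheorem3 {k : Type u} [Field k] [IsAlgClosed k] [CharZero k]
    (X : Over (Spec (CommRingCat.of k))) [IsAlgebraicVariety X]
    (C : Set (VarietyPoint X)) (hC : C ∈ (localRingSetoid X).classes) (hfin : C.Finite)
    (hmeet : ∀ Z ∈ irreducibleComponents X.left, ∃ x ∈ C, x.1 ∈ Z) :
    IsJordanGroup (Aut X) := by
  have : IsReduced X.left := IsAlgebraicVariety.isReduced
  have : IsSeparated X.hom := IsAlgebraicVariety.isSeparated
  have : LocallyOfFiniteType X.hom := IsAlgebraicVariety.locallyOfFiniteType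
  have : Fintype C := hfin.fintype
  choose J hJ using fun x : C => exists_index_bound_of_fixed x.1
  refine ⟨(∏ x : C, J x * C.ncard).factorial, Nat.factorial_pos _, fun K _ => ?_⟩
  have horbit : ∀ x ∈ C, MulAction.orbit K x ⊆ C := by
    obtain ⟨y, rfl⟩ := hC
    rintro x hx _ ⟨g, rfl⟩
    exact (localRingSetoid X).trans ((localRingSetoid X).symm (localRingSetoid_smul g.1 x)) hx
  have hpt : ∀ x : C, ∃ A : Subgroup K, A.index ≤ J x * C.ncard ∧ ∀ a ∈ A, ∀ b ∈ A,
      X.left.fromSpecStalk x.1.1 ≫ ((a * b)⁻¹ : K).1.hom.left =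
        X.left.fromSpecStalk x.1.1 ≫ ((b * a)⁻¹ : K).1.hom.left := fun x => by
    obtain ⟨A, hA, h⟩ := hJ x (K.subtype.comp (MulAction.stabilizer K x.1).subtype) fun g => g.2
    refine ⟨A.map (MulAction.stabilizer K x.1).subtype, ?_, ?_⟩
    · -- The stabilizer has index the size of the orbit, which lies in `C`.
      rw [Subgroup.index_map_subtype, MulAction.index_stabilizer]
      exact Nat.mul_le_mul hA (Set.ncard_le_ncard (horbit x.1 x.2) hfin)
    · rintro _ ⟨a, ha, rfl⟩ _ ⟨b, hb, rfl⟩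
      exact h a ha b hb
  choose A hA hcomm using hpt
  refine ⟨(⨅ x, A x).normalCore, inferInstance, ⟨⟨fun a b => ?_⟩⟩,
    (index_normalCore_le_factorial _).trans (Nat.factorial_le
      ((Subgroup.index_iInf_le A).trans (Finset.prod_le_prod' fun x _ => hA x)))⟩
  have ha := Subgroup.mem_iInf.1 (Subgroup.normalCore_le _ a.2)
  have hb := Subgroup.mem_iInf.1 (Subgroup.normalCore_le _ b.2)
  have h : ((a.1 * b.1)⁻¹ : K).1.hom = ((b.1 * a.1)⁻¹ : K).1.hom :=
    eq_of_fromSpecStalk_comp_eq hmeet fun x hx => hcomm ⟨x, hx⟩ _ (ha ⟨x, hx⟩) _ (hb ⟨x, hx⟩)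
  exact Subtype.ext (inv_injective (Subtype.ext (Aut.ext h)))
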